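/- A semi-Markovian graph (SMG) is a finite graph $G$ on observed vertices $\mathbf V$ with directed edges forming no directed cycle and with bidirected edges $A\leftrightarrow B$ ($A\ne B$), each standing for an unobserved common parent of $A$ and $B$. $An(\mathbf Y)_G$ is the set of ancestors of $\mathbf Y$, including $\mathbf Y$; $G[\mathbf A]$ is the subgraph induced by $\mathbf A$, with its directed and bidirected edges. For $\mathbf A\subseteq\mathbf V$ the latent projection $L(G,\mathbf A)$ is the SMG on $\mathbf A$ in which, for distinct $Z,T\in\mathbf A$: $Z\to T$ iff there is a directed path from $Z$ to $T$ in $G$ whose intermediate vertices are all latent (outside $\mathbf A$, or unobserved); $Z\leftrightarrow T$ iff there is a path between $Z$ and $T$ without colliders whose intermediate vertices are all latent and whose first and last edges point into $Z$ and into $T$ respectively. A causal model with graph $G$ consists of mutually independent unobserved random variables $\mathbf U$ and, for every $V\in\mathbf V$, a measurable function giving the value of $V$ (in a countable set) from the values of the parents of $V$ in $G$ and of some of the variables in $\mathbf U$, where two distinct observed variables may share an argument in $\mathbf U$ only if they are joined by a bidirected edge. (Semi-Markovian models, in which each $U\in\mathbf U$ occurs in at most two functions, are a special case. Functions may ignore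 some of their arguments.) $P(\mathbf V)$ is the joint distribution of $\mathbf V$ in the model, and $P_{x}(\mathbf y)$ is the probability of $\mathbf Y=\mathbf y$ after the function of $X$ has been replaced by the constant $x$. For a joint distribution $Q$ of the vertices of $G$ induced by some model with graph $G$, the number $q$ is the value of the causal effect obtained from $Q$ in $G$ if $P_x(\mathbf y)=q$ in every model with graph $G$ whose joint distribution is $Q$. **Statement.** Let $G$ be an SMG with vertex set $\mathbf V$, let $\mathbf Y\subseteq\mathbf V$, and let $X\neq W$ with $X,W\in An(\mathbf Y)_G$ and $W\notin\mathbf Y$. Let $G'=L\bigl(G[An(\mathbf Y)_G],\,An(\mathbf Y)_G\setminus\{W\}\bigr)$, and suppose that in $G'$ there is no path consisting of bidirected edges from $X$ to any child of $X$ (other than $X$ itself). Let $x$ and $\mathbf y$ be values of $X$ and $\mathbf Y$. Then: 1. the causal effect of $x$ on $\mathbf y$ is identifiable in $G'$: any two models with graph $G'$ that have the same strictly positive joint distribution have the same $P_x(\mathbf y)$; 2. for every model with graph $G$ and joint distribution $P$ for which the marginal $P'=P(An(\mathbf Y)_G\setminus\{W\})$ is strictly positive, $P'$ is the joint distribution of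 some model with graph $G'$, and the causal effect $P_x(\mathbf y)$ obtained from $P$ in $G$ and the causal effect $P'_x(\mathbf y)$ obtained from $P'$ in $G'$ both exist and are equal, their common value being $P_x(\mathbf y)$ in the given model. -/

import Mathlib

open MeasureTheory ProbabilityTheory

universe u v w

/-- A semi-Markovian graph: a finite set `verts` of observed vertices, directed edges
`dir a b` (that is `a → b`) without directed cycles, and bidirected edges `bidir a b`
(that is `a ↔ b`), each standing for an unobserved common parent of `a` and `b`. -/
structure SMG (α : Type u) where
  verts : Set α
  finite_verts : verts.Finite
  dir : α → α → Prop
  bidir : α → α → Prop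
  dir_mem : ∀ a b, dir a b → a ∈ verts ∧ b ∈ verts
  bidir_mem : ∀ a b, bidir a b → a ∈ verts ∧ b ∈ verts
  bidir_symm : ∀ a b, bidir a b → bidir b a
  bidir_irrefl : ∀ a, ¬ bidir a a
  acyclic : ∀ a, ¬ Relation.TransGen dir a a

section Paths

variable {N : Type u}

/-- There is a directed path `z → ⋯ → t` of positive length, for the edge relation `E`,
on which every vertex except `z` and `t` is latent, i.e. outside `obs`. -/
def LatentDirectedPath (E : N → N → Prop) (obs : Set N) (z t : N) : Prop :=
  ∃ (k : ℕ) (p : ℕ → N), 0 < k ∧ p 0 = z ∧ p k = t ∧ Set.InjOn p (Set.Iic k) ∧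
    (∀ i, i < k → E (p i) (p (i + 1))) ∧
    (∀ i, 0 < i → i < k → p i ∉ obs)

/-- There is a path between `z` and `t` (edges may be traversed in both directions) without
colliders, on which every vertex except `z` and `t` is latent, i.e. outside `obs`, and whose
first and last edge have an arrowhead pointing into `z` and into `t` respectively. -/
def LatentConfoundingPath (E : N → N → Prop) (obs : Set N) (z t : N) : Prop :=
  ∃ (k : ℕ) (p : ℕ → N), 0 < k ∧ p 0 = z ∧ p k = t ∧ Set.InjOn p (Set.Iic k) ∧
    (∀ i, i < k → E (p i) (p (i + 1)) ∨ E (p (i + 1)) (p i)) ∧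
    (∀ i, 0 < i → i < k → p i ∉ obs) ∧
    (∀ i, 0 < i → i < k → ¬ (E (p (i - 1)) (p i) ∧ E (p (i + 1)) (p i))) ∧
    E (p 1) (p 0) ∧ E (p (k - 1)) (p k)

theorem LatentConfoundingPath.symm {E : N → N → Prop} {obs : Set N} {z t : N}
    (h : LatentConfoundingPath E obs z t) : LatentConfoundingPath E obs t z := by
  obtain ⟨k, p, hk, h0, h1, hinj, hE, hobs, hcol, ha, hb⟩ := h
  refine ⟨k, fun i => p (k - i), hk, by simpa using h1, by simpa using h0, ?_, ?_, ?_, ?_, ?_, ?_⟩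
  · intro i hi j hj hij
    simp only [Set.mem_Iic] at hi hj
    have := hinj (Set.mem_Iic.2 (Nat.sub_le k i)) (Set.mem_Iic.2 (Nat.sub_le k j)) hij
    omega
  · intro i hi
    have := hE (k - (i + 1)) (by omega)
    rw [show k - (i + 1) + 1 = k - i by omega] at this
    exact this.symm
  · intro i h0 h1
    exact hobs (k - i) (by omega) (by omega)
  · intro i h0 h1 h
    refine hcol (k - i) (by omega) (by omega) ⟨?_, ?_⟩
    · rw [show k - i - 1 = k - (i + 1) by omega]
      exact h.2
    · rw [show k - i + 1 = k - (i - 1) by omega]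
      exact h.1
  · simpa using hb
  · show E (p (k - (k - 1))) (p (k - k))
    rw [show k - (k - 1) = 1 by omega, Nat.sub_self]
    exact ha

end Paths

namespace SMG

variable {α : Type u}

/-- The ancestors of `Y` in `G`, including the elements of `Y` themselves. -/
def An (G : SMG α) (Y : Set α) : Set α :=
  {a | a ∈ G.verts ∧ ∃ b ∈ Y, Relation.ReflTransGen G.dir a b}

theorem An_subset (G : SMG α) (Y : Set α) : G.An Y ⊆ G.verts := fun _ h => h.1

/-- The subgraph `G[A]` induced by `A`; it retains all directed and bidirected edges
between vertices in `A`. -/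
def induce (G : SMG α) (A : Set α) (hA : A ⊆ G.verts) : SMG α where
  verts := A
  finite_verts := G.finite_verts.subset hA
  dir a b := a ∈ A ∧ b ∈ A ∧ G.dir a b
  bidir a b := a ∈ A ∧ b ∈ A ∧ G.bidir a b
  dir_mem _ _ h := ⟨h.1, h.2.1⟩
  bidir_mem _ _ h := ⟨h.1, h.2.1⟩
  bidir_symm a b h := ⟨h.2.1, h.1, G.bidir_symm a b h.2.2⟩
  bidir_irrefl a h := G.bidir_irrefl a h.2.2
  acyclic a h := by
    have key : ∀ b, Relation.TransGen (fun a b => a ∈ A ∧ b ∈ A ∧ G.dir a b) a b →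
        Relation.TransGen G.dir a b := by
      intro b hb
      induction hb with
      | single h => exact Relation.TransGen.single h.2.2
      | tail _ h ih => exact ih.tail h.2.2
    exact G.acyclic a (key a h)

/-- The edges of the DAG underlying an SMG: its nodes are the observed vertices and one
unobserved parentless vertex for each unordered pair joined by a bidirected edge. -/
def dagEdge (G : SMG α) : α ⊕ Sym2 α → α ⊕ Sym2 α → Prop
  | Sum.inl a, Sum.inl b => G.dir a b
  | Sum.inr e, Sum.inl c => ∃ a b, e = s(a, b) ∧ G.bidir a b ∧ (c = a ∨ c = b)
  | _, Sum.inr _ => False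

theorem transGen_dagEdge (G : SMG α) {p q : α ⊕ Sym2 α}
    (h : Relation.TransGen G.dagEdge p q) (a : α) (hp : p = Sum.inl a) :
    ∃ b, q = Sum.inl b ∧ Relation.TransGen G.dir a b := by
  subst hp
  induction h with
  | @single q h =>
    cases q with
    | inl b => exact ⟨b, rfl, Relation.TransGen.single h⟩
    | inr e => exact h.elim
  | @tail q r _ h ih =>
    obtain ⟨b, rfl, hb⟩ := ih
    cases r with
    | inl c => exact ⟨c, rfl, hb.tail h⟩
    | inr e => exact h.elim

theorem transGen_of_latentDirectedPath {N : Type u} {E : N → N → Prop} {obs : Set N} {z t : N}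
    (h : LatentDirectedPath E obs z t) : Relation.TransGen E z t := by
  obtain ⟨k, p, hk, rfl, rfl, -, hE, -⟩ := h
  have key : ∀ j, j < k → Relation.TransGen E (p 0) (p (j + 1)) := by
    intro j
    induction j with
    | zero => exact fun hj => Relation.TransGen.single (hE 0 hj)
    | succ j ih => exact fun hj => (ih (by omega)).tail (hE (j + 1) hj)
  obtain ⟨m, rfl⟩ : ∃ m, k = m + 1 := ⟨k - 1, by omega⟩
  exact key m (by omega)

/-- The latent projection `L(G, A)`: the vertices outside `A`, together with the unobserved
vertices behind the bidirected edges of `G`, are regarded as latent. -/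
def latentProjection (G : SMG α) (A : Set α) (hA : A ⊆ G.verts) : SMG α where
  verts := A
  finite_verts := G.finite_verts.subset hA
  dir a b := a ∈ A ∧ b ∈ A ∧ a ≠ b ∧
    LatentDirectedPath G.dagEdge (Sum.inl '' A) (Sum.inl a) (Sum.inl b)
  bidir a b := a ∈ A ∧ b ∈ A ∧ a ≠ b ∧
    LatentConfoundingPath G.dagEdge (Sum.inl '' A) (Sum.inl a) (Sum.inl b)
  dir_mem _ _ h := ⟨h.1, h.2.1⟩
  bidir_mem _ _ h := ⟨h.1, h.2.1⟩
  bidir_symm _ _ h := ⟨h.2.1, h.1, h.2.2.1.symm, h.2.2.2.symm⟩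
  bidir_irrefl _ h := h.2.2.1 rfl
  acyclic a h := by
    have key : ∀ b, Relation.TransGen (fun a b => a ∈ A ∧ b ∈ A ∧ a ≠ b ∧
        LatentDirectedPath G.dagEdge (Sum.inl '' A) (Sum.inl a) (Sum.inl b)) a b →
        Relation.TransGen G.dir a b := by
      intro b hb
      have step : ∀ c d, LatentDirectedPath G.dagEdge (Sum.inl '' A) (Sum.inl c) (Sum.inl d) →
          Relation.TransGen G.dir c d := by
        intro c d hcd
        obtain ⟨e, he, hce⟩ :=
          G.transGen_dagEdge (transGen_of_latentDirectedPath hcd) c rfl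
        cases he
        exact hce
      induction hb with
      | single h => exact step _ _ h.2.2.2
      | tail _ h ih => exact ih.trans (step _ _ h.2.2.2)
    exact G.acyclic a (key a h)

/-- The graph `L(G[An(Y)], An(Y) \ {W})`. -/
abbrev ancestralProjection (G : SMG α) (Y : Set α) (W : α) : SMG α :=
  (G.induce (G.An Y) (G.An_subset Y)).latentProjection (G.An Y \ {W})
    (fun _ h => h.1)

end SMG

/-- A probabilistic causal model with graph `G`, in which the observed variable `a` takes its
values in `S a`. The unobserved variables are indexed by `U`, the `i`-th one has values in `D i`,
`P` is their joint distribution, and they are mutually independent. `ch i` is the set of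
observed variables in whose functions the `i`-th unobserved variable occurs; two distinct observed
variables may share an unobserved argument only if they are joined by a bidirected edge of `G`.
The value of `a` is given by `f a` in terms of its unobserved arguments and of its observed
parents in `G`. Semi-Markovian models are the ones in which every `ch i` has at most two elements;
a model with larger sets `ch i` has `G` as the latent projection of its diagram. A function is
allowed to ignore some of its arguments. -/
structure CausalModel {α : Type u} (G : SMG α) (S : α → Type v) where
  U : Type w
  D : U → Type w
  [measurableSpace : ∀ i, MeasurableSpace (D i)]
  P : Measure (∀ i, D i)
  [isProbabilityMeasure : IsProbabilityMeasure P]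
  indep : iIndepFun (fun (i : U) (d : ∀ i, D i) => d i) P
  ch : U → Set α
  bidir_of_mem_ch : ∀ i a b, a ∈ ch i → b ∈ ch i → a ∈ G.verts → b ∈ G.verts → a ≠ b → G.bidir a b
  f : ∀ a : G.verts, (∀ i : {i : U // (a : α) ∈ ch i}, D i) →
    (∀ b : {b : α // G.dir b a}, S b) → S a
  measurable_f : ∀ (a : G.verts) (s : ∀ b : {b : α // G.dir b a}, S b) (t : S a),
    MeasurableSet {d | f a d s = t}

namespace CausalModel

variable {α : Type u} {G : SMG α} {S : α → Type v}

open Classical in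
/-- `s` is the tuple of values of the observed variables in the submodel `M_x`, in which the
functions of the variables in `X` are replaced by the constants `x`, when the unobserved
variables have the values `d`. -/
def IsSolution (M : CausalModel.{u, v, w} G S) (X : Set α) (x : ∀ a : X, S a)
    (d : ∀ i, M.D i) (s : ∀ a : G.verts, S a) : Prop :=
  ∀ a : G.verts, s a =
    if h : (a : α) ∈ X then x ⟨a, h⟩
    else M.f a (fun i => d i) (fun b => s ⟨b, (G.dir_mem b a b.2).1⟩)

/-- In every submodel the unobserved variables determine the observed ones. -/
theorem existsUnique_isSolution (M : CausalModel.{u, v, w} G S) (X : Set α) (x : ∀ a : X, S a)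
    (d : ∀ i, M.D i) : ∃! s : ∀ a : G.verts, S a, M.IsSolution X x d s := by
  classical
  have hfin : Finite G.verts := G.finite_verts
  let r : G.verts → G.verts → Prop := fun a b => G.dir a b
  have hlift : ∀ a b : G.verts, Relation.TransGen r a b → Relation.TransGen G.dir a b :=
    fun a b h => by
      induction h with
      | single h => exact Relation.TransGen.single h
      | tail _ h ih => exact ih.tail h
  have hirr : Std.Irrefl (Relation.TransGen r) := ⟨fun a h => G.acyclic a (hlift a a h)⟩
  have hwf : WellFounded r :=
    Subrelation.wf (fun h => Relation.TransGen.single h)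
      (Finite.wellFounded_of_trans_of_irrefl (Relation.TransGen r))
  let F : ∀ a : G.verts, (∀ b : G.verts, r b a → S b) → S a := fun a ih =>
    if h : (a : α) ∈ X then x ⟨a, h⟩
    else M.f a (fun i => d i) (fun b => ih ⟨b, (G.dir_mem b a b.2).1⟩ b.2)
  refine ⟨fun a => hwf.fix F a, fun a => hwf.fix_eq F a, ?_⟩
  intro s hs
  funext a
  induction a using hwf.induction with
  | _ a ih =>
    rw [hs a, hwf.fix_eq F a]
    by_cases h : (a : α) ∈ X
    · simp only [F, h, dif_pos]
    · simp only [F, h, dif_neg, not_false_eq_true]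
      congr 1
      funext b
      exact ih ⟨b, (G.dir_mem b a b.2).1⟩ b.2

/-- The interventional probability `P_x(y)`: the probability that the variables in `Y` take the
values `y` in the submodel `M_x`. -/
noncomputable def doProb (M : CausalModel.{u, v, w} G S) (X : Set α) (x : ∀ a : X, S a)
    (Y : Set α) (y : ∀ a : Y, S a) : ℝ :=
  letI := M.measurableSpace
  M.P.real {d | ∃ s, M.IsSolution X x d s ∧
    ∀ (a : α) (ha : a ∈ G.verts) (hY : a ∈ Y), s ⟨a, ha⟩ = y ⟨a, hY⟩}

/-- The observational distribution `P(A)` of the variables in `A` (no intervention), given by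
its probability mass function. -/
noncomputable def prob (M : CausalModel.{u, v, w} G S) (A : Set α) (a : ∀ b : A, S b) : ℝ :=
  M.doProb ∅ (fun b => b.2.elim) A a

end CausalModel

section Identification

variable {α : Type u} {S : α → Type v}

/-- `P_x(y)` is identifiable in `G`: it is uniquely determined by the joint distribution of the
observed variables, among all models with graph `G` whose joint distribution is positive. -/
def Identifiable (G : SMG α) (X : Set α) (x : ∀ a : X, S a) (Y : Set α) (y : ∀ a : Y, S a) :
    Prop :=
  ∀ M₁ M₂ : CausalModel.{u, v, w} G S, (∀ a, 0 < M₁.prob G.verts a) →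
    M₁.prob G.verts = M₂.prob G.verts → M₁.doProb X x Y y = M₂.doProb X x Y y

/-- The number `q` is the value of `P_x(y)` obtained from the joint distribution `P` in `G`: `P`
is the joint distribution of some model with graph `G`, and all such models have
`P_x(y) = q`. -/
def IsEffectObtainedFrom (G : SMG α) (P : (∀ a : G.verts, S a) → ℝ)
    (X : Set α) (x : ∀ a : X, S a) (Y : Set α) (y : ∀ a : Y, S a) (q : ℝ) : Prop :=
  (∃ M : CausalModel.{u, v, w} G S, M.prob G.verts = P) ∧
    ∀ M : CausalModel.{u, v, w} G S, M.prob G.verts = P → M.doProb X x Y y = q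

end Identification

/-!
Substitute the functions of the latent variables into each other. This turns a model with graph `G`
into one with graph `L(G[B], A)`, for any ancestral set `B`, and changes no interventional
probability of variables in `A`. Hence it suffices to identify the effect in the projected graph.

There, let `C` be the union of the bidirected components that meet `X`. The factors of the joint
distribution that belong to `C` and to its complement depend on disjoint sets of unobserved
variables, so the joint distribution is the product `Q[C] * Q[Cᶜ]`, and it determines both of them
by marginalization along a topological order. As `X` has no children in `C \ X`, summing `X` out of
`Q[C]` gives `Q[C \ X]`. The joint distribution after the intervention is `Q[C \ X] * Q[Cᶜ]`.
-/

section LatentPaths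

variable {N : Type u} {E : N → N → Prop} {obs : Set N}

/-- `p 0 → p 1 → ⋯ → p k` is a directed walk for the edge relation `E` whose intermediate vertices
are latent, i.e. outside `obs`. In contrast to `LatentDirectedPath`, the vertices are not required
to be distinct (they are if `E` is acyclic), and `k = 0` is allowed. -/
structure IsLatentWalk (E : N → N → Prop) (obs : Set N) (k : ℕ) (p : ℕ → N) : Prop where
  edge : ∀ i < k, E (p i) (p (i + 1))
  latent : ∀ i, 0 < i → i < k → p i ∉ obs

namespace IsLatentWalk

variable {k l : ℕ} {p q : ℕ → N}

theorem injOn_Iic (hE : ∀ a, ¬ Relation.TransGen E a a) (hp : IsLatentWalk E obs k p) :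
    Set.InjOn p (Set.Iic k) := by
  have transGen_of_lt : ∀ i j, i < j → j ≤ k → Relation.TransGen E (p i) (p j) := fun i j hij hj =>
    (transGen_of_succ_of_lt (fun a b => E (p a) (p b))
      (fun m hm => hp.edge m (hm.2.trans_le hj)) hij).lift p fun _ _ => id
  intro i hi j hj hij
  by_contra hne
  rcases lt_or_gt_of_ne hne with h | h
  · exact hE _ (hij ▸ transGen_of_lt i j h hj)
  · exact hE _ (hij ▸ transGen_of_lt j i h hi)

theorem drop (hp : IsLatentWalk E obs k p) (j : ℕ) :
    IsLatentWalk E obs (k - j) fun i => p (j + i) where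
  edge i hi := hp.edge (j + i) (by omega)
  latent i h0 hi := hp.latent (j + i) (by omega) (by omega)

theorem cons {z : N} (hp : IsLatentWalk E obs k p) (hz : E z (p 0)) (h0 : p 0 ∉ obs) :
    IsLatentWalk E obs (k + 1) fun i => i.casesOn z p where
  edge
    | 0, _ => hz
    | i + 1, hi => hp.edge i (by omega)
  latent
    | 1, _, _ => h0
    | i + 2, _, hi => hp.latent (i + 1) (by omega) (by omega)

/-- The walk that traverses `p` backwards from `p k` to `p 0 = q 0` and then follows `q`. -/
def reverseAppend (k : ℕ) (p q : ℕ → N) (i : ℕ) : N :=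
  if i ≤ k then p (k - i) else q (i - k)

theorem reverseAppend_of_le {i : ℕ} (hi : i ≤ k) : reverseAppend k p q i = p (k - i) :=
  if_pos hi

theorem reverseAppend_of_ge (h0 : p 0 = q 0) {i : ℕ} (hi : k ≤ i) :
    reverseAppend k p q i = q (i - k) := by
  rcases hi.eq_or_lt with rfl | hi
  · simpa [reverseAppend] using h0
  · exact if_neg hi.not_ge

theorem edge_reverseAppend_of_lt (hp : IsLatentWalk E obs k p) {i : ℕ} (hi : i < k) :
    E (reverseAppend k p q (i + 1)) (reverseAppend k p q i) := by
  rw [reverseAppend_of_le hi, reverseAppend_of_le hi.le, show k - i = k - (i + 1) + 1 by omega]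
  exact hp.edge _ (by omega)

theorem edge_reverseAppend_of_ge (hq : IsLatentWalk E obs l q) (h0 : p 0 = q 0) {i : ℕ}
    (hi : k ≤ i) (hil : i < k + l) :
    E (reverseAppend k p q i) (reverseAppend k p q (i + 1)) := by
  rw [reverseAppend_of_ge h0 hi, reverseAppend_of_ge h0 (by omega), Nat.sub_add_comm hi]
  exact hq.edge _ (by omega)

theorem reverseAppend_notMem (hp : IsLatentWalk E obs k p) (hq : IsLatentWalk E obs l q)
    (h0 : p 0 = q 0) (hlat : p 0 ∉ obs) {i : ℕ} (hi : 0 < i) (hil : i < k + l) :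
    reverseAppend k p q i ∉ obs := by
  rcases lt_trichotomy i k with h | rfl | h
  · rw [reverseAppend_of_le h.le]
    exact hp.latent _ (by omega) (by omega)
  · rwa [reverseAppend_of_le le_rfl, Nat.sub_self]
  · rw [reverseAppend_of_ge h0 h.le]
    exact hq.latent _ (by omega) (by omega)

theorem injOn_reverseAppend (hE : ∀ a, ¬ Relation.TransGen E a a) (hp : IsLatentWalk E obs k p)
    (hq : IsLatentWalk E obs l q) (h0 : p 0 = q 0)
    (hne : ∀ i j, 0 < i → i ≤ k → 0 < j → j ≤ l → p i ≠ q j) :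
    Set.InjOn (reverseAppend k p q) (Set.Iic (k + l)) := by
  intro i hi j hj hij
  rw [Set.mem_Iic] at hi hj
  wlog h : i ≤ j generalizing i j
  · exact (this hj hi hij.symm (le_of_not_ge h)).symm
  by_cases hjk : j ≤ k
  · rw [reverseAppend_of_le (h.trans hjk), reverseAppend_of_le hjk] at hij
    have := hp.injOn_Iic hE (Nat.sub_le k i) (Nat.sub_le k j) hij
    omega
  by_cases hik : k ≤ i
  · rw [reverseAppend_of_ge h0 hik, reverseAppend_of_ge h0 (hik.trans h)] at hij
    have := hq.injOn_Iic hE (show i - k ≤ l by omega) (show j - k ≤ l by omega) hij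
    omega
  · rw [reverseAppend_of_le (by omega), reverseAppend_of_ge h0 (by omega)] at hij
    exact absurd hij (hne _ _ (by omega) (by omega) (by omega) (by omega))

theorem latentConfoundingPath_of_forall_ne (hE : ∀ a, ¬ Relation.TransGen E a a)
    (hp : IsLatentWalk E obs k p) (hq : IsLatentWalk E obs l q) (hk : 0 < k) (hl : 0 < l)
    (h0 : p 0 = q 0) (hlat : p 0 ∉ obs)
    (hne : ∀ i j, 0 < i → i ≤ k → 0 < j → j ≤ l → p i ≠ q j) :
    LatentConfoundingPath E obs (p k) (q l) := by
  have asymm : ∀ {a b}, E a b → ¬ E b a := fun h h' => hE _ (.tail (.single h) h')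
  refine ⟨k + l, reverseAppend k p q, by omega, reverseAppend_of_le (Nat.zero_le k), ?_,
    injOn_reverseAppend hE hp hq h0 hne, fun i hi => ?_,
    fun i => reverseAppend_notMem hp hq h0 hlat, fun i hi hil hcollider => ?_,
    edge_reverseAppend_of_lt hp hk, ?_⟩
  · rw [reverseAppend_of_ge h0 (Nat.le_add_right k l), Nat.add_sub_cancel_left]
  · exact (lt_or_ge i k).symm.imp (edge_reverseAppend_of_ge hq h0 · hi)
      (edge_reverseAppend_of_lt hp)
  · rcases le_total i k with h | h
    · have := edge_reverseAppend_of_lt (q := q) hp (show i - 1 < k by omega)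
      rw [Nat.sub_add_cancel hi] at this
      exact asymm this hcollider.1
    · exact asymm (edge_reverseAppend_of_ge hq h0 h hil) hcollider.2
  · have := edge_reverseAppend_of_ge (k := k) hq h0 (show k ≤ k + l - 1 by omega) (by omega)
    rwa [Nat.sub_add_cancel (by omega)] at this

/-- A vertex shared by the two walks is again a latent common ancestor, so the walks can be
shortened until they meet only in their starting point. -/
theorem latentConfoundingPath (hE : ∀ a, ¬ Relation.TransGen E a a)
    (hp : IsLatentWalk E obs k p) (hq : IsLatentWalk E obs l q) (h0 : p 0 = q 0)
    (hlat : p 0 ∉ obs) (hpk : p k ∈ obs) (hql : q l ∈ obs) (hne : p k ≠ q l) :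
    LatentConfoundingPath E obs (p k) (q l) := by
  induction hn : k + l using Nat.strong_induction_on generalizing k l p q with
  | _ n ih =>
    subst hn
    have pos : ∀ {m} {r : ℕ → N}, r 0 ∉ obs → r m ∈ obs → 0 < m := fun h h' =>
      Nat.pos_of_ne_zero fun hm => h (hm ▸ h')
    by_cases hmeet : ∃ i j, 0 < i ∧ i ≤ k ∧ 0 < j ∧ j ≤ l ∧ p i = q j
    · obtain ⟨i, j, hi, hik, hj, hjl, hij⟩ := hmeet
      have hi_lt : i < k := hik.lt_of_ne <| by
        rintro rfl
        rcases hjl.eq_or_lt with rfl | hjl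
        · exact hne hij
        · exact hq.latent j hj hjl (hij ▸ hpk)
      have hj_lt : j < l := hjl.lt_of_ne <| by
        rintro rfl
        exact hp.latent i hi hi_lt (hij ▸ hql)
      have hpk' : p (i + (k - i)) = p k := by rw [Nat.add_sub_cancel' hik]
      have hql' : q (j + (l - j)) = q l := by rw [Nat.add_sub_cancel' hjl]
      have := ih ((k - i) + (l - j)) (by omega) (hp.drop i) (hq.drop j) hij
        (hp.latent i hi hi_lt) (hpk'.symm ▸ hpk) (hql'.symm ▸ hql) (by rwa [hpk', hql']) rfl
      rwa [hpk', hql'] at this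
    · push Not at hmeet
      exact latentConfoundingPath_of_forall_ne hE hp hq (pos hlat hpk) (pos (h0 ▸ hlat) hql) h0 hlat
        hmeet

end IsLatentWalk

variable {z m t a b : N}

theorem LatentDirectedPath.of_edge (hE : ∀ a, ¬ Relation.TransGen E a a) (h : E z t) :
    LatentDirectedPath E obs z t :=
  have hp : IsLatentWalk E obs 1 fun i => i.casesOn z fun _ => t :=
    ⟨fun i hi => by simpa [Nat.lt_one_iff.1 hi] using h, fun i h0 h1 => by omega⟩
  ⟨1, _, one_pos, rfl, rfl, hp.injOn_Iic hE, hp.edge, hp.latent⟩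

theorem LatentDirectedPath.cons (hE : ∀ a, ¬ Relation.TransGen E a a) (h : E z m) (hm : m ∉ obs)
    (hmt : LatentDirectedPath E obs m t) : LatentDirectedPath E obs z t := by
  obtain ⟨k, p, -, rfl, rfl, -, edge, latent⟩ := hmt
  have hp := IsLatentWalk.cons ⟨edge, latent⟩ h hm
  exact ⟨k + 1, _, k.succ_pos, rfl, rfl, hp.injOn_Iic hE, hp.edge, hp.latent⟩

theorem LatentConfoundingPath.of_latentDirectedPath (hE : ∀ a, ¬ Relation.TransGen E a a)
    (hm : m ∉ obs) (ha : a ∈ obs) (hb : b ∈ obs) (hab : a ≠ b)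
    (hma : LatentDirectedPath E obs m a) (hmb : LatentDirectedPath E obs m b) :
    LatentConfoundingPath E obs a b := by
  obtain ⟨k, p, -, rfl, rfl, -, edge_p, latent_p⟩ := hma
  obtain ⟨l, q, -, hq0, rfl, -, edge_q, latent_q⟩ := hmb
  exact IsLatentWalk.latentConfoundingPath hE ⟨edge_p, latent_p⟩ ⟨edge_q, latent_q⟩ hq0.symm hm
    ha hb hab

end LatentPaths

namespace SMG

variable {α : Type u} {G H : SMG α} {A B : Set α} {a b c : α}

theorem not_transGen_dagEdge_self (G : SMG α) (p : α ⊕ Sym2 α) :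
    ¬ Relation.TransGen G.dagEdge p p := by
  intro h
  cases p with
  | inl a =>
    obtain ⟨b, hb, hab⟩ := G.transGen_dagEdge h a rfl
    exact G.acyclic a (Sum.inl_injective hb ▸ hab)
  | inr e =>
    obtain ⟨q, -, hq⟩ := Relation.TransGen.tail'_iff.1 h
    cases q <;> exact hq

theorem wellFounded_dir (G : SMG α) : WellFounded fun a b : G.verts => G.dir a b :=
  have : Finite G.verts := G.finite_verts
  have : IsTrans G.verts fun a b => Relation.TransGen G.dir a b := ⟨fun _ _ _ => .trans⟩
  have : Std.Irrefl fun a b : G.verts => Relation.TransGen G.dir a b := ⟨fun a => G.acyclic a⟩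
  Subrelation.wf .single
    (Finite.wellFounded_of_trans_of_irrefl fun a b : G.verts => Relation.TransGen G.dir a b)

theorem exists_mem_forall_not_dir (G : SMG α) {A : Set G.verts} (hA : A.Nonempty) :
    ∃ n ∈ A, ∀ a ∈ A, ¬ G.dir n a := by
  have : Finite G.verts := G.finite_verts
  let r : G.verts → G.verts → Prop := fun a b => Relation.TransGen G.dir b a
  have : IsTrans G.verts r := ⟨fun _ _ _ h h' => h'.trans h⟩
  have : Std.Irrefl r := ⟨fun a => G.acyclic a⟩
  obtain ⟨n, hn, hmin⟩ := (Finite.wellFounded_of_trans_of_irrefl r).has_min A hA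
  exact ⟨n, hn, fun a ha h => hmin a ha (.single h)⟩

/-- `B` is ancestral: it contains the parents of its elements. -/
def IsAncestral (G : SMG α) (B : Set α) : Prop :=
  ∀ ⦃a b⦄, G.dir a b → b ∈ B → a ∈ B

theorem isAncestral_An (G : SMG α) (Y : Set α) : G.IsAncestral (G.An Y) := by
  rintro a b hab ⟨-, c, hc, hbc⟩
  exact ⟨(G.dir_mem a b hab).1, c, hc, .head hab hbc⟩

/-- There is a directed path from `c` to `a`, possibly of length zero, on which every vertex except
`a` is outside `A`. The value of `a` is then influenced by that of `c`, and by the unobserved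
arguments of `c`, when the vertices of `A` other than `a` are held fixed. -/
def LatentAncestor (G : SMG α) (A : Set α) : α → α → Prop :=
  Relation.ReflTransGen fun b c => b ∉ A ∧ G.dir b c

namespace LatentAncestor

theorem eq_of_mem (h : G.LatentAncestor A c a) (hc : c ∈ A) : c = a :=
  h.cases_head.resolve_right fun ⟨_, hstep, _⟩ => hstep.1 hc

theorem induce (hB : B ⊆ G.verts) (hanc : G.IsAncestral B) (ha : a ∈ B)
    (h : G.LatentAncestor A c a) : c ∈ B ∧ (G.induce B hB).LatentAncestor A c a := by
  induction h using Relation.ReflTransGen.head_induction_on with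
  | refl => exact ⟨ha, .refl⟩
  | head hstep _ ih =>
    have hmem := hanc hstep.2 ih.1
    exact ⟨hmem, .head ⟨hstep.1, hmem, ih.1, hstep.2⟩ ih.2⟩

theorem latentDirectedPath_of_dagEdge (h : G.LatentAncestor A c a) {p : α ⊕ Sym2 α}
    (hp : G.dagEdge p (.inl c)) : LatentDirectedPath G.dagEdge (Sum.inl '' A) p (.inl a) := by
  induction h using Relation.ReflTransGen.head_induction_on generalizing p with
  | refl => exact .of_edge G.not_transGen_dagEdge_self hp
  | head hstep _ ih =>
    exact .cons G.not_transGen_dagEdge_self hp (by simpa using hstep.1) (ih hstep.2)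

theorem latentDirectedPath (h : G.LatentAncestor A c a) (hc : c ∉ A) (ha : a ∈ A) :
    LatentDirectedPath G.dagEdge (Sum.inl '' A) (.inl c) (.inl a) := by
  rcases h.cases_head with rfl | ⟨b, hcb, hba⟩
  · exact absurd ha hc
  · exact latentDirectedPath_of_dagEdge hba (p := .inl c) hcb.2

theorem latentConfoundingPath (ha : a ∈ A) (hb : b ∈ A) (hab : a ≠ b) {c' : α}
    (hcc' : c = c' ∨ G.bidir c c') (hca : G.LatentAncestor A c a)
    (hcb : G.LatentAncestor A c' b) :
    LatentConfoundingPath G.dagEdge (Sum.inl '' A) (.inl a) (.inl b) := by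
  have of_common_ancestor {m : α ⊕ Sym2 α} (hm : m ∉ Sum.inl '' A) :=
    LatentConfoundingPath.of_latentDirectedPath G.not_transGen_dagEdge_self hm
      (Set.mem_image_of_mem _ ha) (Set.mem_image_of_mem _ hb) (Sum.inl_injective.ne hab)
  rcases hcc' with rfl | hcc'
  · have hc : c ∉ A := fun hc => hab ((hca.eq_of_mem hc).symm.trans (hcb.eq_of_mem hc))
    exact of_common_ancestor (by simpa using hc) (hca.latentDirectedPath hc ha)
      (hcb.latentDirectedPath hc hb)
  · exact of_common_ancestor (m := .inr s(c, c')) (by simp)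
      (hca.latentDirectedPath_of_dagEdge ⟨c, c', rfl, hcc', .inl rfl⟩)
      (hcb.latentDirectedPath_of_dagEdge ⟨c, c', rfl, hcc', .inr rfl⟩)

end LatentAncestor

/-- `H` is a graph on some of the vertices of `G` which has at least the edges that are needed for
every model with graph `G` to induce a model with graph `H`; further edges are allowed, since the
functions of a model may ignore some of their arguments. The latent projections of `G` and of its
ancestral subgraphs are such graphs. -/
structure ProjectsTo (G H : SMG α) : Prop where
  verts_subset : H.verts ⊆ G.verts
  dir : ∀ ⦃b c a⦄, b ∈ H.verts → a ∈ H.verts → G.dir b c → G.LatentAncestor H.verts c a → H.dir b a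
  bidir : ∀ ⦃c c' a b⦄, a ∈ H.verts → b ∈ H.verts → a ≠ b → (c = c' ∨ G.bidir c c') →
    G.LatentAncestor H.verts c a → G.LatentAncestor H.verts c' b → H.bidir a b

theorem projectsTo_latentProjection (G : SMG α) (hA : A ⊆ G.verts) :
    G.ProjectsTo (G.latentProjection A hA) where
  verts_subset := hA
  dir b c a hb ha hbc hca := by
    have hpath := hca.latentDirectedPath_of_dagEdge (p := .inl b) hbc
    refine ⟨hb, ha, ?_, hpath⟩
    rintro rfl
    exact G.not_transGen_dagEdge_self _ (transGen_of_latentDirectedPath hpath)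
  bidir _ _ _ _ ha hb hab hcc' hca hcb :=
    ⟨ha, hb, hab, hca.latentConfoundingPath ha hb hab hcc' hcb⟩

theorem ProjectsTo.of_induce {hB : B ⊆ G.verts} (hanc : G.IsAncestral B)
    (h : (G.induce B hB).ProjectsTo H) : G.ProjectsTo H where
  verts_subset := h.verts_subset.trans hB
  dir b c a hb ha hbc hca := by
    have ⟨hc, hca'⟩ := hca.induce hB hanc (h.verts_subset ha)
    exact h.dir hb ha ⟨h.verts_subset hb, hc, hbc⟩ hca'
  bidir c c' a b ha hb hab hcc' hca hcb := by
    have ⟨hc, hca'⟩ := hca.induce hB hanc (h.verts_subset ha)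
    have ⟨hc', hcb'⟩ := hcb.induce hB hanc (h.verts_subset hb)
    exact h.bidir ha hb hab (hcc'.imp_right fun hbi => ⟨hc, hc', hbi⟩) hca' hcb'

end SMG

theorem measureReal_iUnion_eq_tsum {Ω ι : Type*} [MeasurableSpace Ω] [Countable ι]
    (μ : Measure Ω) [IsFiniteMeasure μ] {E : ι → Set Ω}
    (hd : Pairwise (Function.onFun Disjoint E)) (hm : ∀ i, MeasurableSet (E i)) :
    μ.real (⋃ i, E i) = ∑' i, μ.real (E i) := by
  simp only [measureReal_def, measure_iUnion hd hm]
  exact ENNReal.tsum_toReal_eq fun i => measure_ne_top μ _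

theorem measurableSet_setOf_apply_eq {Ω ι γ : Type*} [MeasurableSpace Ω] [Finite ι]
    {T : ι → Type*} [∀ i, Countable (T i)] {F : Ω → (∀ i, T i) → γ} {g : Ω → ∀ i, T i} {t : γ}
    (hF : ∀ r, MeasurableSet {ω | F ω r = t}) (hg : ∀ i r, MeasurableSet {ω | g ω i = r}) :
    MeasurableSet {ω | F ω (g ω) = t} := by
  have hset : {ω | F ω (g ω) = t} =
      ⋃ r : ∀ i, T i, {ω | F ω r = t} ∩ ⋂ i, {ω | g ω i = r i} := by
    ext ω
    simp [← funext_iff]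
  rw [hset]
  exact .iUnion fun r => (hF r).inter (.iInter fun i => hg i (r i))

namespace CausalModel

attribute [instance] CausalModel.measurableSpace CausalModel.isProbabilityMeasure

variable {α : Type u} {G H : SMG α} {S : α → Type v}

/-- The event that the functions of the variables in `A` return the values `v`, when their observed
arguments have the values `v`. -/
def localEvent (M : CausalModel.{u, v, w} G S) (A : Set G.verts) (v : ∀ a : G.verts, S a) :
    Set (∀ i, M.D i) :=
  {d | ∀ a ∈ A, M.f a (fun i => d i) (fun b => v ⟨b, (G.dir_mem b a b.2).1⟩) = v a}

/-- The factor `Q[A](v)` of Tian and Pearl: the probability of `localEvent`. It is the c-factor of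
`A` if `A` is a component of `G` with respect to the bidirected edges. -/
noncomputable def cFactor (M : CausalModel.{u, v, w} G S) (A : Set G.verts)
    (v : ∀ a : G.verts, S a) : ℝ :=
  M.P.real (M.localEvent A v)

section Factors

variable (M : CausalModel.{u, v, w} G S) {A B : Set G.verts} (v : ∀ a : G.verts, S a)

theorem localEvent_anti (h : A ⊆ B) : M.localEvent B v ⊆ M.localEvent A v :=
  fun _ hd a ha => hd a (h ha)

theorem localEvent_union : M.localEvent (A ∪ B) v = M.localEvent A v ∩ M.localEvent B v := by
  ext d
  simp [localEvent, or_imp, forall_and]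

theorem measurableSet_localEvent_iSup (A : Set G.verts) :
    MeasurableSet[⨆ i ∈ {i | ∃ a ∈ A, (a : α) ∈ M.ch i},
      MeasurableSpace.comap (fun d : ∀ i, M.D i => d i) (M.measurableSpace i)]
      (M.localEvent A v) := by
  have : Finite G.verts := G.finite_verts
  let m := ⨆ i ∈ {i | ∃ a ∈ A, (a : α) ∈ M.ch i},
    MeasurableSpace.comap (fun d : ∀ i, M.D i => d i) (M.measurableSpace i)
  have measurable_args : ∀ a ∈ A, Measurable[m, MeasurableSpace.pi]
      fun (d : ∀ i, M.D i) (i : {i : M.U // (a : α) ∈ M.ch i}) => d i := fun a ha =>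
    @measurable_pi_lambda _ _ _ m _ _ fun i =>
      (comap_measurable _).mono (le_iSup₂_of_le (i : M.U) ⟨a, ha, i.2⟩ le_rfl) le_rfl
  have hset : M.localEvent A v = ⋂ a ∈ A, (fun (d : ∀ i, M.D i)
      (i : {i : M.U // (a : α) ∈ M.ch i}) => d i) ⁻¹'
        {d | M.f a d (fun b => v ⟨b, (G.dir_mem b a b.2).1⟩) = v a} := by
    ext d
    simp [localEvent]
  rw [hset]
  exact @MeasurableSet.biInter _ _ m _ _ A.to_countable fun a ha =>
    measurable_args a ha (M.measurable_f a _ _)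

theorem measurableSet_localEvent (A : Set G.verts) : MeasurableSet (M.localEvent A v) :=
  iSup₂_le (fun i _ => (measurable_pi_apply i).comap_le) _ (M.measurableSet_localEvent_iSup v A)

theorem cFactor_anti (h : A ⊆ B) : M.cFactor B v ≤ M.cFactor A v :=
  measureReal_mono (M.localEvent_anti v h)

theorem cFactor_union (hAB : Disjoint A B) (h : ∀ a ∈ A, ∀ b ∈ B, ¬ G.bidir a b) :
    M.cFactor (A ∪ B) v = M.cFactor A v * M.cFactor B v := by
  have hdisj : Disjoint {i | ∃ a ∈ A, (a : α) ∈ M.ch i} {i | ∃ b ∈ B, (b : α) ∈ M.ch i} := by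
    rw [Set.disjoint_left]
    rintro i ⟨a, ha, hai⟩ ⟨b, hb, hbi⟩
    refine h a ha b hb (M.bidir_of_mem_ch i a b hai hbi a.2 b.2 fun hab => ?_)
    exact Set.disjoint_left.1 hAB ha (Subtype.ext hab ▸ hb)
  have hind := indep_iSup_of_disjoint (μ := M.P)
    (fun i => (measurable_pi_apply (X := M.D) i).comap_le) M.indep hdisj
  have hinter := (Indep_iff _ _ M.P).1 hind _ _ (M.measurableSet_localEvent_iSup v A)
    (M.measurableSet_localEvent_iSup v B)
  simp only [cFactor, measureReal_def, localEvent_union, hinter, ENNReal.toReal_mul]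

open Classical in
theorem mem_localEvent_insert_update {n : G.verts} (hn : n ∉ A) (hpa : ∀ a ∈ A, ¬ G.dir n a)
    (t : S n) (d : ∀ i, M.D i) :
    d ∈ M.localEvent (insert n A) (Function.update v n t) ↔
      M.f n (fun i => d i) (fun b => v ⟨b, (G.dir_mem b n b.2).1⟩) = t ∧
        d ∈ M.localEvent A v := by
  have update_parents : ∀ a : G.verts, ¬ G.dir n a →
      (fun b : {b : α // G.dir b a} => Function.update v n t ⟨b, (G.dir_mem b a b.2).1⟩) =
        fun b : {b : α // G.dir b a} => v ⟨b, (G.dir_mem b a b.2).1⟩ := fun a ha =>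
    funext fun b => Function.update_of_ne (fun hb => ha (congrArg Subtype.val hb ▸ b.2)) _ _
  simp only [localEvent, Set.mem_ofPred_eq, Set.forall_mem_insert]
  refine and_congr ?_ (forall₂_congr fun a ha => ?_)
  · rw [update_parents n fun h => G.acyclic n (.single h), Function.update_self]
  · rw [update_parents a (hpa a ha), Function.update_of_ne (ne_of_mem_of_not_mem ha hn)]

open Classical in
theorem cFactor_eq_tsum_update [∀ a, Countable (S a)] {n : G.verts} (hn : n ∉ A)
    (hpa : ∀ a ∈ A, ¬ G.dir n a) :
    M.cFactor A v = ∑' t : S n, M.cFactor (insert n A) (Function.update v n t) := by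
  have hmem := M.mem_localEvent_insert_update v hn hpa
  have hset : M.localEvent A v =
      ⋃ t : S n, M.localEvent (insert n A) (Function.update v n t) := by
    ext d
    simp only [Set.mem_iUnion, hmem, exists_eq_left']
  rw [cFactor, hset, measureReal_iUnion_eq_tsum _ ?_ fun t => M.measurableSet_localEvent _ _]
  · rfl
  · intro t t' htt'
    refine Set.disjoint_left.2 fun d hd hd' => htt' ?_
    rw [← ((hmem t d).1 hd).1, ((hmem t' d).1 hd').1]

end Factors

section Determined

variable [∀ a, Countable (S a)] {M₁ M₂ : CausalModel.{u, v, w} G S} {A B : Set G.verts}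

/-- The variables in `B \ A` are summed out one by one, children before parents. -/
theorem cFactor_congr_of_subset (hAB : A ⊆ B) (hch : ∀ b ∈ B \ A, ∀ a ∈ A, ¬ G.dir b a)
    (h : M₁.cFactor B = M₂.cFactor B) : M₁.cFactor A = M₂.cFactor A := by
  classical
  have : Finite G.verts := G.finite_verts
  induction B using WellFoundedLT.induction with
  | ind B ih =>
    rcases (B \ A).eq_empty_or_nonempty with hBA | hBA
    · rwa [hAB.antisymm (Set.sdiff_eq_empty.1 hBA)]
    · obtain ⟨n, hn, hsink⟩ := G.exists_mem_forall_not_dir hBA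
      have hn_insert : insert n (B \ {n}) = B := Set.insert_sdiff_self_of_mem hn.1
      have hno_child : ∀ a ∈ B \ {n}, ¬ G.dir n a := fun a ha =>
        if haA : a ∈ A then hch n hn a haA else hsink a ⟨ha.1, haA⟩
      refine ih (B \ {n}) (Set.sdiff_singleton_ssubset.2 hn.1)
        (Set.subset_sdiff_singleton hAB hn.2) (fun b hb => hch b ⟨hb.1.1, hb.2⟩)
        (funext fun v => ?_)
      rw [M₁.cFactor_eq_tsum_update v (fun h => h.2 rfl) hno_child,
        M₂.cFactor_eq_tsum_update v (fun h => h.2 rfl) hno_child, hn_insert, h]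

/-- The last variable of `A ∪ B` in a topological order can be summed out. If it belongs to `A`,
then the factor of `B` is known by induction, and that of `A` is obtained by division. -/
theorem cFactor_congr_of_union (hAB : Disjoint A B) (hbi : ∀ a ∈ A, ∀ b ∈ B, ¬ G.bidir a b)
    (hpos : ∀ v, 0 < M₁.cFactor (A ∪ B) v) (h : M₁.cFactor (A ∪ B) = M₂.cFactor (A ∪ B)) :
    M₁.cFactor A = M₂.cFactor A ∧ M₁.cFactor B = M₂.cFactor B := by
  have : Finite G.verts := G.finite_verts
  induction hU : A ∪ B using WellFoundedLT.induction generalizing A B with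
  | ind U ih =>
    subst hU
    rcases (A ∪ B).eq_empty_or_nonempty with hempty | hne
    · obtain ⟨rfl, rfl⟩ := Set.union_empty_iff.1 hempty
      simpa using h
    · obtain ⟨n, hn, hsink⟩ := G.exists_mem_forall_not_dir hne
      wlog hnA : n ∈ A generalizing A B
      · rw [Set.union_comm] at hpos h hne hn hsink ih
        exact (this hAB.symm (fun b hb a ha hba => hbi a ha b hb (G.bidir_symm _ _ hba)) hpos h ih
          hne hn hsink (hn.resolve_right hnA)).symm
      have hnB : n ∉ B := Set.disjoint_left.1 hAB hnA
      have hunion : A \ {n} ∪ B = (A ∪ B) \ {n} := by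
        rw [Set.union_sdiff_distrib, Set.sdiff_singleton_eq_self hnB]
      have hsub : A \ {n} ∪ B ⊆ A ∪ B := hunion ▸ Set.sdiff_subset
      have hB : M₁.cFactor B = M₂.cFactor B := by
        refine (ih _ (hunion ▸ Set.sdiff_singleton_ssubset.2 hn)
          (hAB.mono_left Set.sdiff_subset) (fun a ha => hbi a ha.1)
          (fun v => (hpos v).trans_le (M₁.cFactor_anti v hsub))
          (cFactor_congr_of_subset hsub ?_ h) rfl).2
        rintro b ⟨hb, hb'⟩ a ha
        obtain rfl : b = n := by_contra fun hbn => hb' (hunion ▸ ⟨hb, hbn⟩)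
        exact hsink a (hsub ha)
      refine ⟨funext fun v => mul_right_cancel₀ (b := M₁.cFactor B v) ?_ ?_, hB⟩
      · exact ((hpos v).trans_le (M₁.cFactor_anti v Set.subset_union_right)).ne'
      · rw [← M₁.cFactor_union v hAB hbi, h, M₂.cFactor_union v hAB hbi, hB]

/-- With `C` the union of the confounded components that meet `X`, the factor of `Xᶜ` is
`Q[C \ X] * Q[Cᶜ]`. The joint distribution `Q[C] * Q[Cᶜ]` determines `Q[C]` and `Q[Cᶜ]`, and
`Q[C \ X]` is obtained from `Q[C]` by summing out `X`. -/
theorem cFactor_compl_congr {X : Set G.verts} (hpos : ∀ v, 0 < M₁.cFactor Set.univ v)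
    (h : M₁.cFactor Set.univ = M₂.cFactor Set.univ)
    (hpath : ∀ a ∈ X, ∀ c ∉ X, G.dir a c → ∀ b ∈ X, ¬ Relation.TransGen G.bidir b c) :
    M₁.cFactor Xᶜ = M₂.cFactor Xᶜ := by
  let C : Set G.verts := {c | ∃ b ∈ X, Relation.ReflTransGen G.bidir b c}
  have hXC : X ⊆ C := fun a ha => ⟨a, ha, .refl⟩
  have hC : ∀ a ∈ C, ∀ b ∈ Cᶜ, ¬ G.bidir a b := fun a ⟨z, hz, hza⟩ b hb hab =>
    hb ⟨z, hz, hza.tail hab⟩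
  have hchild : ∀ b ∈ C \ (C \ X), ∀ c ∈ C \ X, ¬ G.dir b c := by
    rintro b ⟨hbC, hb⟩ c ⟨⟨z, hz, hzc⟩, hcX⟩ hbc
    have hbX : b ∈ X := by_contra fun hbX => hb ⟨hbC, hbX⟩
    rcases Relation.reflTransGen_iff_eq_or_transGen.1 hzc with hcz | hzc
    · exact hcX (Subtype.ext hcz ▸ hz)
    · exact hpath b hbX c hcX hbc z hz hzc
  obtain ⟨hQC, hQC'⟩ : M₁.cFactor C = M₂.cFactor C ∧ M₁.cFactor Cᶜ = M₂.cFactor Cᶜ :=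
    cFactor_congr_of_union disjoint_compl_right hC (by rwa [Set.union_compl_self])
      (by rwa [Set.union_compl_self])
  have hQCX : M₁.cFactor (C \ X) = M₂.cFactor (C \ X) :=
    cFactor_congr_of_subset Set.sdiff_subset hchild hQC
  have hsplit : Xᶜ = C \ X ∪ Cᶜ := by
    rw [Set.sdiff_eq, Set.union_comm, Set.union_inter_distrib_left, Set.compl_union_self,
      Set.univ_inter, Set.union_eq_right.2 (Set.compl_subset_compl.2 hXC)]
  have hfac (M : CausalModel.{u, v, w} G S) (v) :
      M.cFactor Xᶜ v = M.cFactor (C \ X) v * M.cFactor Cᶜ v := by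
    rw [hsplit]
    exact M.cFactor_union v (disjoint_compl_right.mono_left Set.sdiff_subset) fun a ha => hC a ha.1
  funext v
  rw [hfac, hfac, hQCX, hQC']

end Determined

section TruncatedFactorization

theorem isSolution_iff (M : CausalModel.{u, v, w} G S) (X : Set α) (x : ∀ a : X, S a)
    (d : ∀ i, M.D i) (s : ∀ a : G.verts, S a) :
    M.IsSolution X x d s ↔ (∀ (a : G.verts) (h : (a : α) ∈ X), s a = x ⟨a, h⟩) ∧
      d ∈ M.localEvent {a | (a : α) ∉ X} s := by
  constructor
  · intro h
    refine ⟨fun a ha => ?_, fun a ha => ?_⟩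
    · rw [h a, dif_pos ha]
    · rw [h a, dif_neg ha]
  · rintro ⟨h, h'⟩ a
    by_cases ha : (a : α) ∈ X
    · rw [dif_pos ha, h a ha]
    · rw [dif_neg ha, h' a ha]

theorem prob_verts (M : CausalModel.{u, v, w} G S) (v : ∀ a : G.verts, S a) :
    M.prob G.verts v = M.cFactor Set.univ v := by
  unfold prob doProb cFactor
  congr 1
  ext d
  simp only [Set.mem_ofPred_eq, isSolution_iff]
  constructor
  · rintro ⟨s, hs, h⟩
    obtain rfl : s = v := funext fun a => h a a.2 a.2
    simpa using hs.2
  · intro h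
    exact ⟨v, ⟨fun _ h => h.elim, by simpa using h⟩, fun _ _ _ => rfl⟩

theorem doProb_eq_tsum [∀ a, Countable (S a)] (M : CausalModel.{u, v, w} G S) (X : Set α)
    (x : ∀ a : X, S a) (Y : Set α) (y : ∀ a : Y, S a) :
    M.doProb X x Y y =
      ∑' s : {s : ∀ a : G.verts, S a // (∀ (a : G.verts) (h : (a : α) ∈ X), s a = x ⟨a, h⟩) ∧
          ∀ (a : α) (ha : a ∈ G.verts) (hY : a ∈ Y), s ⟨a, ha⟩ = y ⟨a, hY⟩},
        M.cFactor {a | (a : α) ∉ X} s := by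
  have : Finite G.verts := G.finite_verts
  unfold doProb cFactor
  rw [← measureReal_iUnion_eq_tsum M.P ?_ fun s => M.measurableSet_localEvent _ _]
  · congr 1
    ext d
    simp only [Set.mem_ofPred_eq, Set.mem_iUnion, isSolution_iff, Subtype.exists, exists_prop]
    exact exists_congr fun s => by tauto
  · rintro ⟨s, hs⟩ ⟨s', hs'⟩ hss'
    refine Set.disjoint_left.2 fun d hd hd' => hss' (Subtype.ext ?_)
    exact (M.existsUnique_isSolution X x d).unique ((M.isSolution_iff X x d s).2 ⟨hs.1, hd⟩)
      ((M.isSolution_iff X x d s').2 ⟨hs'.1, hd'⟩)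

theorem prob_congr [∀ a, Countable (S a)] {M₁ M₂ : CausalModel.{u, v, w} G S}
    (h : M₁.prob G.verts = M₂.prob G.verts) (A : Set α) : M₁.prob A = M₂.prob A := by
  funext a
  unfold prob
  rw [doProb_eq_tsum, doProb_eq_tsum]
  refine tsum_congr fun s => ?_
  have huniv : {a : G.verts | (a : α) ∉ (∅ : Set α)} = Set.univ := by simp
  rw [huniv, ← prob_verts, ← prob_verts, h]

end TruncatedFactorization

end CausalModel

theorem identifiable_of_forall_not_transGen_bidir {α : Type u} {S : α → Type v}
    [∀ a, Countable (S a)] (G : SMG α) (X : Set α)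
    (hpath : ∀ a ∈ X, ∀ c ∉ X, G.dir a c → ∀ b ∈ X, ¬ Relation.TransGen G.bidir b c)
    (x : ∀ a : X, S a) (Y : Set α) (y : ∀ a : Y, S a) :
    Identifiable.{u, v, w} G X x Y y := by
  intro M₁ M₂ hpos h
  have hcompl : M₁.cFactor {a | (a : α) ∉ X} = M₂.cFactor {a | (a : α) ∉ X} := by
    refine CausalModel.cFactor_compl_congr (X := {a : G.verts | (a : α) ∈ X})
      (fun v => ?_) (funext fun v => ?_) fun a ha c hc hac b hb => hpath a ha c hc hac b hb
    · rw [← M₁.prob_verts]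
      exact hpos v
    · rw [← M₁.prob_verts, h, M₂.prob_verts]
  rw [CausalModel.doProb_eq_tsum, CausalModel.doProb_eq_tsum, hcompl]

namespace CausalModel

variable {α : Type u} {G H : SMG α} {S : α → Type v} {Y : Set α}

section Projection

variable (M : CausalModel.{u, v, w} G S)

/-- The observed variables in `A` on which the `i`-th unobserved variable acts directly or through
variables outside `A`. -/
def latentCh (A : Set α) (i : M.U) : Set α :=
  {a | ∃ c ∈ G.verts, c ∈ M.ch i ∧ G.LatentAncestor A c a}

open Classical in
/-- The value of a latent ancestor `c` of `a`, when the parents of `a` in `H` have the values `s`: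
the functions of the latent variables between them are substituted. For `c = a` this is the function
of `a` in the projected model. -/
noncomputable def latentValue (h : G.ProjectsTo H) {a : α} (ha : a ∈ H.verts)
    (d : ∀ i : {i // a ∈ M.latentCh H.verts i}, M.D i) (s : ∀ b : {b // H.dir b a}, S b) :
    ∀ c : G.verts, G.LatentAncestor H.verts c a → S c :=
  G.wellFounded_dir.fix fun c value hc =>
    M.f c (fun i => d ⟨i, c, c.2, i.2, hc⟩) fun b =>
      if hb : (b : α) ∈ H.verts then s ⟨b, h.dir hb ha b.2 hc⟩
      else value ⟨b, (G.dir_mem b c b.2).1⟩ b.2 (.head ⟨hb, b.2⟩ hc)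

open Classical in
theorem latentValue_eq (h : G.ProjectsTo H) {a : α} (ha : a ∈ H.verts)
    (d : ∀ i : {i // a ∈ M.latentCh H.verts i}, M.D i) (s : ∀ b : {b // H.dir b a}, S b)
    (c : G.verts) (hc : G.LatentAncestor H.verts c a) :
    M.latentValue h ha d s c hc =
      M.f c (fun i => d ⟨i, c, c.2, i.2, hc⟩) fun b =>
        if hb : (b : α) ∈ H.verts then s ⟨b, h.dir hb ha b.2 hc⟩
        else M.latentValue h ha d s ⟨b, (G.dir_mem b c b.2).1⟩ (.head ⟨hb, b.2⟩ hc) := by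
  unfold latentValue
  rw [G.wellFounded_dir.fix_eq]

theorem measurableSet_latentValue [∀ a, Countable (S a)] (h : G.ProjectsTo H) {a : α}
    (ha : a ∈ H.verts) (s : ∀ b : {b // H.dir b a}, S b) (c : G.verts)
    (hc : G.LatentAncestor H.verts c a) (t : S c) :
    MeasurableSet {d | M.latentValue h ha d s c hc = t} := by
  induction c using G.wellFounded_dir.induction with
  | _ c ih =>
    have : Finite {b : α // G.dir b c} := G.finite_verts.subset fun b hb => (G.dir_mem b c hb).1
    simp only [latentValue_eq]
    refine measurableSet_setOf_apply_eq (fun r => ?_) fun b t => ?_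
    · have measurable_args : Measurable fun (d : ∀ i : {i // a ∈ M.latentCh H.verts i}, M.D i)
          (i : {i : M.U // (c : α) ∈ M.ch i}) => d ⟨i, c, c.2, i.2, hc⟩ :=
        measurable_pi_lambda _ fun i => measurable_pi_apply _
      exact measurable_args (M.measurable_f c r t)
    · by_cases hb : (b : α) ∈ H.verts
      · simp [hb]
      · simpa only [hb, dif_neg, not_false_eq_true] using ih ⟨b, _⟩ b.2 (.head ⟨hb, b.2⟩ hc) t

/-- The model with graph `H` in which the functions of the vertices of `G` outside `H` have been
substituted; the unobserved variables remain the same. -/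
noncomputable def project [∀ a, Countable (S a)] (h : G.ProjectsTo H) :
    CausalModel.{u, v, w} H S where
  U := M.U
  D := M.D
  P := M.P
  indep := M.indep
  ch := M.latentCh H.verts
  bidir_of_mem_ch := by
    rintro i a b ⟨c, hc, hci, hca⟩ ⟨c', hc', hci', hcb⟩ ha hb hab
    exact h.bidir ha hb hab (or_iff_not_imp_left.2 (M.bidir_of_mem_ch i c c' hci hci' hc hc'))
      hca hcb
  f a d s := M.latentValue h a.2 d s ⟨a, h.verts_subset a.2⟩ .refl
  measurable_f a s t := M.measurableSet_latentValue h a.2 s ⟨a, h.verts_subset a.2⟩ .refl t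

variable {M} {X : Set α} {x : ∀ a : X, S a} {d : ∀ i, M.D i} {s : ∀ a : G.verts, S a}

theorem IsSolution.latentValue_eq (hs : M.IsSolution X x d s) (h : G.ProjectsTo H)
    (hX : X ⊆ H.verts) {a : α} (ha : a ∈ H.verts) (c : G.verts)
    (hc : G.LatentAncestor H.verts c a) (hcX : (c : α) ∉ X) :
    M.latentValue h ha (fun i => d i)
      (fun b => s ⟨b, h.verts_subset (H.dir_mem b a b.2).1⟩) c hc = s c := by
  induction c using G.wellFounded_dir.induction with
  | _ c ih =>
    rw [M.latentValue_eq, hs c, dif_neg hcX]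
    congr 1
    funext b
    split_ifs with hb
    · rfl
    · exact ih ⟨b, _⟩ b.2 _ fun hbX => hb (hX hbX)

variable [∀ a, Countable (S a)]

theorem IsSolution.project (hs : M.IsSolution X x d s) (h : G.ProjectsTo H) (hX : X ⊆ H.verts) :
    (M.project h).IsSolution X x d fun a => s ⟨a, h.verts_subset a.2⟩ := by
  intro a
  split_ifs with haX
  · exact (hs _).trans (dif_pos haX)
  · exact (hs.latentValue_eq h hX a.2 ⟨a, h.verts_subset a.2⟩ .refl haX).symm

variable (M)

theorem doProb_project (h : G.ProjectsTo H) (hX : X ⊆ H.verts) (x : ∀ a : X, S a)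
    (hY : Y ⊆ H.verts) (y : ∀ a : Y, S a) : (M.project h).doProb X x Y y = M.doProb X x Y y := by
  unfold doProb
  refine congrArg M.P.real (Set.ext fun d => ?_)
  constructor
  · rintro ⟨s', hs', hy⟩
    obtain ⟨s, hs, -⟩ := M.existsUnique_isSolution X x d
    obtain rfl := ((M.project h).existsUnique_isSolution X x d).unique hs' (hs.project h hX)
    exact ⟨s, hs, fun a _ haY => hy a (hY haY) haY⟩
  · rintro ⟨s, hs, hy⟩
    exact ⟨_, hs.project h hX, fun a ha haY => hy a (h.verts_subset ha) haY⟩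

theorem prob_project (h : G.ProjectsTo H) : (M.project h).prob H.verts = M.prob H.verts :=
  funext fun a => M.doProb_project h (Set.empty_subset _) _ subset_rfl a

end Projection

end CausalModel

theorem mainTheorem7_general {α : Type u} {S : α → Type v} [∀ a, Countable (S a)]
    (G : SMG α) {B : Set α} (hB : B ⊆ G.verts) (hanc : G.IsAncestral B)
    {A : Set α} (hA : A ⊆ B) {X Y : Set α} (hX : X ⊆ A) (hY : Y ⊆ A)
    (hpath : ∀ a ∈ X, ∀ c ∉ X, ((G.induce B hB).latentProjection A hA).dir a c →
      ∀ b ∈ X, ¬ Relation.TransGen ((G.induce B hB).latentProjection A hA).bidir b c)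
    (x : ∀ a : X, S a) (y : ∀ a : Y, S a) :
    Identifiable.{u, v, w} ((G.induce B hB).latentProjection A hA) X x Y y ∧
    ∀ M : CausalModel.{u, v, w} G S, (∀ a, 0 < M.prob A a) →
      IsEffectObtainedFrom.{u, v, w} G (M.prob G.verts) X x Y y (M.doProb X x Y y) ∧
      IsEffectObtainedFrom.{u, v, w} ((G.induce B hB).latentProjection A hA) (M.prob A)
        X x Y y (M.doProb X x Y y) := by
  have hproj : G.ProjectsTo ((G.induce B hB).latentProjection A hA) :=
    .of_induce hanc ((G.induce B hB).projectsTo_latentProjection hA)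
  have hid := identifiable_of_forall_not_transGen_bidir.{u, v, w} _ X hpath x Y y
  refine ⟨hid, fun M hpos => ?_⟩
  have effect_eq : ∀ M' : CausalModel.{u, v, w} ((G.induce B hB).latentProjection A hA) S,
      M'.prob A = M.prob A → M'.doProb X x Y y = M.doProb X x Y y := fun M' hM' => by
    rw [← M.doProb_project hproj hX x hY y]
    refine (hid _ M' (fun a => ?_) ((M.prob_project hproj).trans hM'.symm)).symm
    rw [M.prob_project hproj]
    exact hpos a
  refine ⟨⟨⟨M, rfl⟩, fun M' hM' => ?_⟩, ⟨M.project hproj, M.prob_project hproj⟩, effect_eq⟩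
  rw [← M'.doProb_project hproj hX x hY y]
  exact effect_eq _ ((M'.prob_project hproj).trans (CausalModel.prob_congr hM' A))

theorem mainTheorem7 {α : Type u} {S : α → Type v} [∀ a, Countable (S a)]
    (G : SMG α) (Y : Set α) (hY : Y ⊆ G.verts) (X W : α) (hXW : X ≠ W) (hWY : W ∉ Y)
    (hX : X ∈ G.An Y) (hW : W ∈ G.An Y)
    (hpath : ∀ C, (G.ancestralProjection Y W).dir X C →
      ¬ Relation.TransGen (G.ancestralProjection Y W).bidir X C)
    (x : ∀ a : ({X} : Set α), S a) (y : ∀ a : Y, S a) :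
    Identifiable.{u, v, w} (G.ancestralProjection Y W) {X} x Y y ∧
    ∀ M : CausalModel.{u, v, w} G S,
      (∀ a : (∀ b : (G.An Y \ {W} : Set α), S b), 0 < M.prob (G.An Y \ {W}) a) →
        IsEffectObtainedFrom.{u, v, w} G (M.prob G.verts) {X} x Y y
          (M.doProb {X} x Y y) ∧
        IsEffectObtainedFrom.{u, v, w} (G.ancestralProjection Y W) (M.prob (G.An Y \ {W}))
          {X} x Y y (M.doProb {X} x Y y) := by
  refine mainTheorem7_general G (G.An_subset Y) (G.isAncestral_An Y) (fun _ ha => ha.1) ?_ ?_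
    (by rintro _ rfl c - hc _ rfl; exact hpath c hc) x y
  · exact Set.singleton_subset_iff.2 ⟨hX, hXW⟩
  · exact fun a ha => ⟨⟨hY ha, a, ha, .refl⟩, fun haW => hWY (haW ▸ ha)⟩
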